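/- All logarithms are to the base $2$. A $k$-box is a product of $k$ nonempty closed intervals of $\mathbb{R}$, and the boxicity $\mathrm{box}(G)$ of a finite simple graph $G$ is the least integer $k\ge 0$ for which one can assign a $k$-box to every vertex of $G$ so that two distinct vertices are adjacent if and only if their boxes intersect (so complete graphs have boxicity $0$). The hypercube $K_2^d$ is the $d$-th Cartesian power of the complete graph $K_2$. The dimension of a poset $P$ is the least positive integer $k$ such that the order of $P$ is the intersection of $k$ linear extensions of $P$. Theorem 2.4. For $d\ge 1$ let $b_d$ be the largest dimension of a poset formed by two adjacent levels of the Boolean lattice on $d$ elements, that is, by the subsets of $\{1,\dots,d\}$ of size $j-1$ or $j$, ordered by inclusion, for some $1\le j\le d$. Then $$\tfrac12\, b_d \le \mathrm{box}(K_2^d)\quad\text{for all } d\ge 2,\qquad \mathrm{box}(K_2^d)\le 3\,b_d\quad\text{for all } d\ge 1.$$ Furthermore, for all $d\ge 3$, $$\mathrm{box}(K_2^d)\le \frac{12\log d}{\log\log d}.$$ -/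

import Mathlib

/-- A `k`-box: a product of `k` (nonempty) closed intervals of the real line. -/
def IsBox {k : ℕ} (S : Set (Fin k → ℝ)) : Prop :=
  ∃ a b : Fin k → ℝ, (∀ i, a i ≤ b i) ∧ S = Set.univ.pi fun i => Set.Icc (a i) (b i)

/-- `f` is a `k`-box representation of `G`. -/
def IsBoxRepresentation {V : Type*} (G : SimpleGraph V) {k : ℕ}
    (f : V → Set (Fin k → ℝ)) : Prop :=
  (∀ v, IsBox (f v)) ∧ ∀ u v, u ≠ v → (G.Adj u v ↔ (f u ∩ f v).Nonempty)

/-- The boxicity of a graph: the least natural number `k` (possibly `0`) for which the graph has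
a `k`-box representation. For a finite graph such `k` exist, see `exists_isBoxRepresentation`. -/
noncomputable def boxicity {V : Type*} (G : SimpleGraph V) : ℕ :=
  sInf {k : ℕ | ∃ f : V → Set (Fin k → ℝ), IsBoxRepresentation G f}

/-- The `d`-th Cartesian power of a graph: two tuples are adjacent iff they are adjacent in one
coordinate and agree in all the others. -/
def cartesianPower {V : Type*} (G : SimpleGraph V) (d : ℕ) : SimpleGraph (Fin d → V) where
  Adj u v := ∃ i, G.Adj (u i) (v i) ∧ ∀ j, j ≠ i → u j = v j
  symm := ⟨fun _ _ ⟨i, h, h'⟩ => ⟨i, h.symm, fun j hj => (h' j hj).symm⟩⟩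
  loopless := ⟨fun _ ⟨_, h, _⟩ => h.ne rfl⟩

/-- The `d`-dimensional hypercube: the `d`-th Cartesian power of the complete graph on two
vertices. -/
def hypercube (d : ℕ) : SimpleGraph (Fin d → Fin 2) :=
  cartesianPower (⊤ : SimpleGraph (Fin 2)) d

/-- `L` is a linear extension of the order of `P`. -/
def IsLinearExtension {P : Type*} [PartialOrder P] (L : P → P → Prop) : Prop :=
  IsLinearOrder P L ∧ ∀ x y, x ≤ y → L x y

/-- A realiser of `P` of size `k`: linear extensions `L 0, …, L (k - 1)` whose intersection is
the order of `P`. -/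
def IsRealiser {P : Type*} [PartialOrder P] {k : ℕ} (L : Fin k → P → P → Prop) : Prop :=
  (∀ i, IsLinearExtension (L i)) ∧ ∀ x y, x ≤ y ↔ ∀ i, L i x y

/-- The (Dushnik–Miller) dimension of a poset: the least positive integer `k` such that the poset
has a realiser of size `k`. For a finite poset such `k` exist, see `exists_isRealiser`. -/
noncomputable def posetDim (P : Type*) [PartialOrder P] : ℕ :=
  sInf {k : ℕ | 0 < k ∧ ∃ L : Fin k → P → P → Prop, IsRealiser L}

/-- The Hamming weight: the number of ones of a 0-1 vector. -/
def weight {d : ℕ} (v : Fin d → Fin 2) : ℕ :=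
  (Finset.univ.filter fun i => v i = 1).card

/-- Levels `j` and `j + 1` of the Boolean lattice on `d` elements, which is the set of 0-1 vectors
of length `d` ordered coordinatewise; this subtype carries the induced order. -/
abbrev AdjacentLevels (d j : ℕ) : Type :=
  {v : Fin d → Fin 2 // weight v = j ∨ weight v = j + 1}

/-- `b_d`: the largest dimension of a poset formed by two adjacent levels `j`, `j + 1`
(`0 ≤ j < d`) of the Boolean lattice on `d` elements. -/
noncomputable def maxAdjacentLevelsDim (d : ℕ) : ℕ :=
  (Finset.range d).sup fun j => posetDim (AdjacentLevels d j)

/-- Every finite graph has a box representation, so `boxicity` is a genuine minimum. -/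
theorem exists_isBoxRepresentation {V : Type*} [Finite V] (G : SimpleGraph V) :
    ∃ (k : ℕ) (f : V → Set (Fin k → ℝ)), IsBoxRepresentation G f := by
  classical
  obtain ⟨k, ⟨e⟩⟩ := Finite.exists_equiv_fin V
  -- in the coordinate of `w`: `w ↦ [0,0]`, neighbours of `w` to `[0,1]`, all others to `[1,1]`
  let a : V → Fin k → ℝ := fun v i => if v = e.symm i ∨ G.Adj v (e.symm i) then 0 else 1
  let b : V → Fin k → ℝ := fun v i => if v = e.symm i then 0 else 1
  have hab : ∀ v i, a v i ≤ b v i := by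
    intro v i
    simp only [a, b]
    split_ifs <;> simp_all
  refine ⟨k, fun v => Set.univ.pi fun i => Set.Icc (a v i) (b v i),
    fun v => ⟨a v, b v, hab v, rfl⟩, ?_⟩
  intro u v huv
  constructor
  · intro h
    refine ⟨fun i => if u = e.symm i ∨ v = e.symm i then 0 else 1, ?_, ?_⟩ <;>
    · intro i _
      have h' := h.symm
      simp only [a, b, Set.mem_Icc]
      by_cases h1 : u = e.symm i <;> by_cases h2 : v = e.symm i <;> simp_all <;>
        split_ifs <;> norm_num
  · rintro ⟨x, hu, hv⟩
    by_contra h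
    have h1 := hu (e u) trivial
    have h2 := hv (e u) trivial
    have h' : ¬ G.Adj v u := fun h2 => h h2.symm
    simp [a, b, Ne.symm huv, h'] at h1 h2
    linarith [h1, h2]

/-- Every finite poset has a realiser of positive size, so `posetDim` is a genuine minimum. -/
theorem exists_isRealiser (P : Type*) [PartialOrder P] [Finite P] :
    ∃ k : ℕ, 0 < k ∧ ∃ L : Fin k → P → P → Prop, IsRealiser L := by
  classical
  have key : ∀ p : Option {p : P × P // ¬ p.1 ≤ p.2}, ∃ L : P → P → Prop, IsLinearExtension L ∧
      ∀ q, p = some q → ¬ L q.1.1 q.1.2 := by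
    rintro (_ | ⟨⟨x, y⟩, hxy⟩)
    · obtain ⟨s, hs, h⟩ := extend_partialOrder (α := P) (· ≤ ·)
      exact ⟨s, ⟨hs, fun x y hh => h x y hh⟩, by simp⟩
    · have : IsPartialOrder P fun a b => a ≤ b ∨ (a ≤ y ∧ x ≤ b) :=
        { refl := fun a => Or.inl le_rfl
          trans := by
            rintro a b c (h | ⟨h, h'⟩) (g | ⟨g, g'⟩)
            · exact Or.inl (h.trans g)
            · exact Or.inr ⟨h.trans g, g'⟩
            · exact Or.inr ⟨h, h'.trans g⟩
            · exact Or.inr ⟨h, g'⟩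
          antisymm := by
            rintro a b (h | ⟨h, h'⟩) (g | ⟨g, g'⟩)
            · exact le_antisymm h g
            · exact absurd ((g'.trans h).trans g) hxy
            · exact absurd ((h'.trans g).trans h) hxy
            · exact absurd (h'.trans g) hxy }
      obtain ⟨s, hs, h⟩ := extend_partialOrder fun a b : P => a ≤ b ∨ (a ≤ y ∧ x ≤ b)
      refine ⟨s, ⟨hs, fun a b hh => h a b (Or.inl hh)⟩, ?_⟩
      rintro q hq hs'
      cases hq
      have h2 : s y x := h y x (Or.inr ⟨le_rfl, le_rfl⟩)
      have : x = y := hs.toIsPartialOrder.antisymm _ _ hs' h2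
      exact hxy this.le
  choose L hL hL' using key
  obtain ⟨k, ⟨e⟩⟩ := Finite.exists_equiv_fin (Option {p : P × P // ¬ p.1 ≤ p.2})
  refine ⟨k, Fin.pos (e none), fun i => L (e.symm i), fun i => hL _, fun x y => ⟨?_, ?_⟩⟩
  · intro h i
    exact (hL _).2 x y h
  · intro h
    by_contra hxy
    have := h (e (some ⟨(x, y), hxy⟩))
    simp only [e.symm_apply_apply] at this
    exact hL' _ _ rfl this

/-!
The comparison with the dimension of two adjacent levels rests on two translations.

* A box representation of the cube gives, for each coordinate, two linear extensions of the poset on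
  levels `j` and `j + 1`: one sorts the lower level by left and the upper level by right endpoints,
  the other does the same after a reflection of the line. Comparable vertices have intersecting
  intervals, so this extends the order; disjoint intervals are ordered oppositely by the two. Hence
  `b_d ≤ 2 box` (`posetDim_adjacentLevels_le`).
* Conversely, suppose that for every `j` the order between levels `j` and `j + 1` is realised by `k`
  position functions (`IsLevelRealiser`). Position functions for all `j` of one parity fit into one
  interval graph: the pairs of levels occupy consecutive unit segments of the line, and intervals
  are prolonged just far enough for consecutive segments to meet. The two parities take `2 k`
  coordinates, and two more separate the vertices of equal weight, so `box ≤ 2 k + 2`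
  (`boxicity_hypercube_le_of_isLevelRealiser`). With `k = b_d ≥ 2` this is at most `3 b_d`.

For the explicit bound, `2 q` position functions are found whenever `d ≤ q!`. Identify the elements
of the ground set with repetition-free words of length `q`. For each letter `r`, partition the
ground set by the prefixes that end in `r`, ordered so that at every branching of the tree of words
the branch of `r` comes first (`cutWord`). Sort the sets of a level by the size of their first part,
ties by an arbitrary order of the first parts, then by the second part, and so on; each `r` is used
twice, with opposite orders for the ties (`partKey`). If `|B| = |A| + 1` and `A ⊄ B`, consider the
first position at which the words of the elements of the symmetric difference `D` are not all the
same. At least two letters occur there and `B` has only one element more than `A`, so for some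
occurring letter `r` the set `A` has at least as many elements of `D` with this letter as `B`. These
elements form the first part that `D` meets in the order of `r`, which puts `A` behind all `B \ {b}`
for one of the two tie-breaking rules (`exists_cutWord`, `exists_partKey_lt`). Thus
`box ≤ 4 q + 2`, and the estimate `n! ≥ (n / e) ^ n` yields a suitable `q` (`exists_le_factorial`).
-/

/-! ### Intervals, realisers and adjacency in the cube -/

theorem boxicity_le_of_intervals {V ι : Type*} [Fintype ι] (G : SimpleGraph V)
    (a b : V → ι → ℝ) (hab : ∀ v i, a v i ≤ b v i)
    (h : ∀ u v, u ≠ v → (G.Adj u v ↔ ∀ i, a u i ≤ b v i ∧ a v i ≤ b u i)) :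
    boxicity G ≤ Fintype.card ι := by
  let e := Fintype.equivFin ι
  refine Nat.sInf_le ⟨fun v => Set.univ.pi fun i => Set.Icc (a v (e.symm i)) (b v (e.symm i)),
    fun v => ⟨fun i => a v (e.symm i), fun i => b v (e.symm i), fun i => hab _ _, rfl⟩, ?_⟩
  intro u v huv
  rw [h u v huv]
  constructor
  · intro hi
    refine ⟨fun i => max (a u (e.symm i)) (a v (e.symm i)), fun i _ => ?_, fun i _ => ?_⟩
    · exact ⟨le_max_left _ _, max_le (hab _ _) (hi _).2⟩
    · exact ⟨le_max_right _ _, max_le (hi _).1 (hab _ _)⟩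
  · rintro ⟨x, hu, hv⟩ i
    have h1 := hu (e i) trivial
    have h2 := hv (e i) trivial
    simp only [Equiv.symm_apply_apply, Set.mem_Icc] at h1 h2
    exact ⟨h1.1.trans h2.2, h2.1.trans h1.2⟩

theorem exists_intervals_of_boxicity {V : Type*} [Finite V] (G : SimpleGraph V) :
    ∃ a b : V → Fin (boxicity G) → ℝ, (∀ v i, a v i ≤ b v i) ∧
      ∀ u v, u ≠ v → (G.Adj u v ↔ ∀ i, a u i ≤ b v i ∧ a v i ≤ b u i) := by
  obtain ⟨f, hf, hadj⟩ : ∃ f : V → Set (Fin (boxicity G) → ℝ), IsBoxRepresentation G f :=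
    Nat.sInf_mem (s := {k : ℕ | ∃ f : V → Set (Fin k → ℝ), IsBoxRepresentation G f})
      (exists_isBoxRepresentation G)
  choose a b hab hS using hf
  refine ⟨a, b, hab, fun u v huv => ?_⟩
  rw [hadj u v huv, hS u, hS v, ← Set.pi_inter_distrib, Set.univ_pi_nonempty_iff]
  refine forall_congr' fun i => ?_
  rw [Set.Icc_inter_Icc, Set.nonempty_Icc, sup_le_iff, le_inf_iff, le_inf_iff]
  have h1 := hab u i
  have h2 := hab v i
  tauto

theorem exists_realiser_posetDim (P : Type*) [PartialOrder P] [Finite P] :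
    0 < posetDim P ∧ ∃ L : Fin (posetDim P) → P → P → Prop, IsRealiser L :=
  Nat.sInf_mem (s := {k : ℕ | 0 < k ∧ ∃ L : Fin k → P → P → Prop, IsRealiser L})
    (exists_isRealiser P)

theorem posetDim_le_of_fintype {P ι : Type*} [PartialOrder P] [Fintype ι] [Nonempty ι]
    (L : ι → P → P → Prop) (hL : ∀ i, IsLinearExtension (L i))
    (h : ∀ x y, (∀ i, L i x y) → x ≤ y) : posetDim P ≤ Fintype.card ι := by
  let e := Fintype.equivFin ι
  refine Nat.sInf_le ⟨Fintype.card_pos, fun i => L (e.symm i), fun i => hL _, fun x y =>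
    ⟨fun hxy i => (hL _).2 x y hxy, fun hxy => h x y fun i => ?_⟩⟩
  simpa using hxy (e i)

theorem isLinearOrder_of_injective {P K : Type*} [LinearOrder K] (f : P → K)
    (hf : Function.Injective f) : IsLinearOrder P fun x y => f x ≤ f y :=
  { refl := fun _ => le_rfl
    trans := fun _ _ _ => le_trans
    antisymm := fun _ _ h h' => hf (le_antisymm h h')
    total := fun _ _ => le_total _ _ }

/-- The support of a 0-1 vector. -/
def ones {d : ℕ} (v : Fin d → Fin 2) : Finset (Fin d) := Finset.univ.filter fun i => v i = 1

theorem mem_ones {d : ℕ} {v : Fin d → Fin 2} {i : Fin d} : i ∈ ones v ↔ v i = 1 := by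
  simp [ones]

theorem card_ones {d : ℕ} (v : Fin d → Fin 2) : (ones v).card = weight v := rfl

theorem ones_injective {d : ℕ} : Function.Injective (ones (d := d)) := by
  intro u v h
  funext i
  have : u i = 1 ↔ v i = 1 := by rw [← mem_ones, ← mem_ones, h]
  generalize u i = x at *
  generalize v i = y at *
  revert this; revert x y; decide

theorem ones_subset {d : ℕ} {u v : Fin d → Fin 2} : ones u ⊆ ones v ↔ u ≤ v := by
  rw [Finset.subset_iff, Pi.le_def]
  refine forall_congr' fun i => ?_
  rw [mem_ones, mem_ones]
  generalize u i = x
  generalize v i = y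
  revert x y; decide

theorem weight_le {d : ℕ} (v : Fin d → Fin 2) : weight v ≤ d := by
  simpa [card_ones] using Finset.card_le_univ (ones v)

theorem adj_of_le {d : ℕ} {u v : Fin d → Fin 2} (h : u ≤ v) (hw : weight v = weight u + 1) :
    (hypercube d).Adj u v := by
  have hs := ones_subset.2 h
  have hc : (ones v \ ones u).card = 1 := by
    rw [Finset.card_sdiff_of_subset hs, card_ones, card_ones]; omega
  obtain ⟨i, hi⟩ := Finset.card_eq_one.1 hc
  have key : ∀ j, (v j = 1 ∧ ¬ u j = 1) ↔ j = i := fun j => by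
    rw [← mem_ones, ← mem_ones, ← Finset.mem_sdiff, hi, Finset.mem_singleton]
  refine ⟨i, ?_, fun j hj => ?_⟩
  · have := (key i).2 rfl
    simp only [SimpleGraph.top_adj]
    intro h'; rw [h'] at this; tauto
  · have h1 := (key j).not.2 hj
    have aux : ∀ x y : Fin 2, ¬ (y = 1 ∧ ¬ x = 1) → x ≤ y → x = y := by decide
    exact aux _ _ h1 (h j)

theorem adj_iff {d : ℕ} {u v : Fin d → Fin 2} (hw : weight u ≤ weight v) :
    (hypercube d).Adj u v ↔ u ≤ v ∧ weight v = weight u + 1 := by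
  refine ⟨?_, fun h => adj_of_le h.1 h.2⟩
  rintro ⟨i, hi, hj⟩
  have hi' : u i ≠ v i := by simpa using hi
  have main : ∀ x y : Fin d → Fin 2, (∀ j, j ≠ i → x j = y j) → x i = 0 → y i = 1 →
      x ≤ y ∧ weight y = weight x + 1 := by
    intro x y hxy hx hy
    have h1 : ones y = insert i (ones x) := by
      ext j
      rw [Finset.mem_insert, mem_ones, mem_ones]
      by_cases hji : j = i
      · subst hji; simp [hy]
      · simp [hji, hxy j hji]
    constructor
    · rw [← ones_subset, h1]; exact Finset.subset_insert _ _
    · rw [← card_ones, h1, Finset.card_insert_of_notMem (by simp [mem_ones, hx]), card_ones]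
  have : (u i = 0 ∧ v i = 1) ∨ (v i = 0 ∧ u i = 1) := by
    generalize u i = x at *
    generalize v i = y at *
    revert hi'; clear hi; revert x y; decide
  rcases this with ⟨h0, h1⟩ | ⟨h0, h1⟩
  · exact main u v hj h0 h1
  · have := (main v u (fun j h => (hj j h).symm) h0 h1).2
    omega

theorem AdjacentLevels.adj_iff_of_lower {d j : ℕ} {u v : AdjacentLevels d j}
    (hu : weight u.1 = j) (hv : weight v.1 = j + 1) : (hypercube d).Adj u.1 v.1 ↔ u ≤ v := by
  rw [adj_iff (by omega), ← Subtype.coe_le_coe]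
  exact ⟨fun h => h.1, fun h => ⟨h, by omega⟩⟩

theorem weight_lt_of_lt {d : ℕ} {u v : Fin d → Fin 2} (h : u < v) : weight u < weight v := by
  rw [← card_ones, ← card_ones]
  refine Finset.card_lt_card (Finset.ssubset_iff_subset_ne.2 ⟨ones_subset.2 h.le, ?_⟩)
  exact fun h' => h.ne (ones_injective h')

/-! ### A small factorial above `d` -/

theorem mul_log_sub_one_le_log_factorial {n : ℕ} (hn : 0 < n) :
    n * (Real.log n - 1) ≤ Real.log (n.factorial : ℝ) := by
  have hn' : (0 : ℝ) < n := by exact_mod_cast hn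
  have hf : (0 : ℝ) < n.factorial := by exact_mod_cast n.factorial_pos
  have h := Real.log_le_log (by positivity) (Real.pow_div_factorial_le_exp (n : ℝ) hn'.le n)
  rw [Real.log_exp, Real.log_div (by positivity) hf.ne', Real.log_pow] at h
  linarith

/-- With `l = log₂ n!` this says `(2 n + 3) log₂ l ≤ 6 l`, the bound needed for `q = n + 1`. -/
theorem log_logb_factorial_le {n : ℕ} (hn : 5 ≤ n) :
    (2 * n + 3) * Real.log (Real.logb 2 n.factorial) ≤
      6 * Real.log 2 * Real.logb 2 n.factorial := by
  set l := Real.logb 2 (n.factorial : ℝ) with hl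
  have hn' : (5 : ℝ) ≤ n := by exact_mod_cast hn
  have l2 := Real.log_two_gt_d9
  have l2' := Real.log_two_lt_d9
  have hf : (120 : ℝ) ≤ n.factorial := by exact_mod_cast Nat.factorial_le hn
  have hmul : l * Real.log 2 = Real.log n.factorial := by
    rw [hl, Real.logb, div_mul_cancel₀ _ (by positivity)]
  have hl6 : 6 ≤ l := by
    rw [hl, Real.le_logb_iff_rpow_le (by norm_num) (by linarith)]
    exact le_trans (by norm_num) hf
  -- the tangent to `log` at `n` bounds `log l`
  have htan : Real.log l ≤ Real.log n + l / n - 1 := by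
    have := Real.log_le_sub_one_of_pos (x := l / n) (by positivity)
    rw [Real.log_div (by positivity) (by positivity)] at this
    linarith
  have key : (2 * n + 3) * (Real.log n - 1) ≤ l * (6 * Real.log 2 - 2 - 3 / n) := by
    -- `2.1588 < 6 log 2 - 2`; below, `1.442 < 1 / log 2`
    have hmain : ∀ m : ℝ, m ≤ l → (2 * n + 3) * (Real.log n - 1) ≤ m * (2.1588 - 3 / n) →
        (2 * n + 3) * (Real.log n - 1) ≤ l * (6 * Real.log 2 - 2 - 3 / n) := by
      intro m hm h
      have h3 : 3 / (n : ℝ) ≤ 3 / 5 := by gcongr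
      refine h.trans ((mul_le_mul_of_nonneg_right hm (by linarith)).trans ?_)
      exact mul_le_mul_of_nonneg_left (by linarith) (by linarith)
    rcases Nat.lt_or_ge n 7 with h7 | h7
    · interval_cases n
      · refine hmain 6 hl6 ?_
        have h5 : Real.log 5 ≤ 1 / 4 + 2 * Real.log 2 := by
          have := Real.log_le_sub_one_of_pos (x := 5 / 4) (by norm_num)
          rw [Real.log_div (by norm_num) (by norm_num), show (4 : ℝ) = 2 ^ 2 by norm_num,
            Real.log_pow] at this
          push_cast at this; linarith
        push_cast; linarith
      · have hl9 : 9 ≤ l := by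
          rw [hl, Real.le_logb_iff_rpow_le (by norm_num) (by linarith)]
          norm_num [Nat.factorial]
        refine hmain 9 hl9 ?_
        have h6 : Real.log 6 ≤ -1 / 4 + 3 * Real.log 2 := by
          have := Real.log_le_sub_one_of_pos (x := 6 / 8) (by norm_num)
          rw [Real.log_div (by norm_num) (by norm_num), show (8 : ℝ) = 2 ^ 3 by norm_num,
            Real.log_pow] at this
          push_cast at this; linarith
        push_cast; linarith
    · have h7' : (7 : ℝ) ≤ n := by exact_mod_cast h7
      have h1 : 0 ≤ Real.log n - 1 := by
        have := Real.one_sub_inv_le_log_of_pos (x := n / 4) (by positivity)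
        rw [Real.log_div (by positivity) (by norm_num), show (4 : ℝ) = 2 ^ 2 by norm_num,
            Real.log_pow] at this
        have h4 : ((n : ℝ) / 2 ^ 2)⁻¹ ≤ 1 := inv_le_one_of_one_le₀ (by linarith)
        push_cast at this; linarith
      refine hmain (1.442 * (n * (Real.log n - 1))) ?_ ?_
      · have h2 := mul_log_sub_one_le_log_factorial (n := n) (by omega)
        nlinarith
      · have : 1.442 * (n * (Real.log n - 1)) * (2.1588 - 3 / n)
            = (1.442 * (2.1588 * n - 3)) * (Real.log n - 1) := by field_simp
        rw [this]
        exact mul_le_mul_of_nonneg_right (by linarith) h1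
  have h2 : (2 * n + 3) * Real.log l ≤ (2 * n + 3) * (Real.log n + l / n - 1) :=
    mul_le_mul_of_nonneg_left htan (by positivity)
  have h3 : (2 * n + 3) * (l / n) = l * (2 + 3 / n) := by field_simp
  linarith

/-- Some `q` with `d ≤ q!` is at most about `3 log d / log log d`. -/
theorem exists_le_factorial {d : ℕ} (hd : 3 ≤ d) :
    ∃ q : ℕ, 0 < q ∧ d ≤ q.factorial ∧
      (4 * q + 2 : ℝ) ≤ 12 * Real.logb 2 d / Real.logb 2 (Real.logb 2 d) := by
  have hd' : (3 : ℝ) ≤ d := by exact_mod_cast hd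
  set x := Real.logb 2 (d : ℝ) with hx
  have hx1 : 1 < x := by
    rw [hx, Real.lt_logb_iff_rpow_lt (by norm_num) (by linarith)]
    norm_num; linarith
  have hlog : 0 < Real.log x := Real.log_pos hx1
  have l2 := Real.log_two_gt_d9
  have suff : ∀ q : ℕ, (2 * q + 1) * Real.log x ≤ 6 * Real.log 2 * x →
      (4 * q + 2 : ℝ) ≤ 12 * x / Real.logb 2 x := by
    intro q h
    rw [Real.logb, div_div_eq_mul_div, le_div_iff₀ hlog]
    linarith
  rcases Nat.lt_or_ge 120 d with h | h
  -- the least `q`: `(q - 1)! < d` then bounds `log d` from below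
  · have hex : ∃ q, d ≤ Nat.factorial q := ⟨d, Nat.self_le_factorial d⟩
    classical
    obtain ⟨q, hq, hmin⟩ : ∃ q, d ≤ Nat.factorial q ∧ ∀ m < q, ¬ d ≤ Nat.factorial m :=
      ⟨Nat.find hex, Nat.find_spec hex, fun m => Nat.find_min hex⟩
    have hq6 : 6 ≤ q := by
      by_contra h6
      have : q.factorial ≤ Nat.factorial 5 := Nat.factorial_le (by omega)
      have h5 : Nat.factorial 5 = 120 := rfl
      omega
    refine ⟨q, by omega, hq, suff q ?_⟩
    obtain ⟨n, rfl⟩ : ∃ n, q = n + 1 := ⟨q - 1, by omega⟩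
    have hn := log_logb_factorial_le (n := n) (by omega)
    have hf : (120 : ℝ) ≤ n.factorial := by
      exact_mod_cast Nat.factorial_le (show 5 ≤ n by omega)
    have hlx : Real.logb 2 n.factorial ≤ x :=
      Real.logb_le_logb_of_le (by norm_num) (by linarith)
        (by exact_mod_cast (not_le.1 (hmin n (by omega))).le)
    have hl6 : 6 ≤ Real.logb 2 n.factorial := by
      rw [Real.le_logb_iff_rpow_le (by norm_num) (by linarith)]
      exact le_trans (by norm_num) hf
    have he := Real.exp_one_lt_d9
    -- `log x / x` decreases for `x ≥ e`
    have hanti := Real.log_div_self_antitoneOn (Set.mem_Ici.2 (by linarith))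
      (Set.mem_Ici.2 (by linarith)) hlx
    simp only at hanti
    have h1 : (2 * n + 3) * (Real.log (Real.logb 2 n.factorial) / Real.logb 2 n.factorial) ≤
        6 * Real.log 2 := by
      rw [← mul_div_assoc, div_le_iff₀ (by linarith)]; exact hn
    have h2 : (2 * n + 3) * (Real.log x / x) ≤ 6 * Real.log 2 :=
      (mul_le_mul_of_nonneg_left hanti (by positivity)).trans h1
    rw [← mul_div_assoc, div_le_iff₀ (by linarith)] at h2
    push_cast
    linarith
  · refine ⟨5, by norm_num, h, suff 5 ?_⟩
    -- `log x ≤ x / e`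
    have he := Real.exp_one_lt_d9
    have hepos := Real.exp_pos 1
    have h1 := Real.log_le_sub_one_of_pos (x := x / Real.exp 1) (by positivity)
    rw [Real.log_div (by positivity) hepos.ne', Real.log_exp] at h1
    have h2 : Real.log x * Real.exp 1 ≤ x := by
      rw [← le_div_iff₀ hepos]; linarith
    have he' : 2.7 < Real.exp 1 := lt_trans (by norm_num) Real.exp_one_gt_d9
    push_cast
    nlinarith

/-! ### Dimension at most twice boxicity -/

/-- Every coordinate `i` of an interval representation of the cube provides two linear extensions:
`(i, true)` sorts lower vertices by left and upper vertices by right endpoints, and `(i, false)` does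
the same after a reflection of the line. -/
theorem posetDim_adjacentLevels_le {d : ℕ} {ι : Type*} [Fintype ι] [Nonempty ι]
    (a b : (Fin d → Fin 2) → ι → ℝ) (hab : ∀ v i, a v i ≤ b v i)
    (h : ∀ u v, u ≠ v → ((hypercube d).Adj u v ↔ ∀ i, a u i ≤ b v i ∧ a v i ≤ b u i)) (j : ℕ) :
    posetDim (AdjacentLevels d j) ≤ 2 * Fintype.card ι := by
  let e := Fintype.equivFin (AdjacentLevels d j)
  let val : ι × Bool → AdjacentLevels d j → ℝ := fun s v =>
    if weight v.1 = j then (if s.2 then a v.1 s.1 else -b v.1 s.1)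
    else (if s.2 then b v.1 s.1 else -a v.1 s.1)
  -- ties are broken in favour of the lower level, then arbitrarily
  let key : ι × Bool → AdjacentLevels d j → ℝ ×ₗ ℕ ×ₗ ℕ := fun s v =>
    toLex (val s v, toLex (weight v.1, (e v : ℕ)))
  have hkey : ∀ s, Function.Injective (key s) := by
    intro s u v huv
    have := congrArg (fun p : ℝ ×ₗ ℕ ×ₗ ℕ => (ofLex (ofLex p).2).2) huv
    exact e.injective (Fin.ext this)
  have hlt : ∀ s u v, val s u < val s v → key s u < key s v := fun s u v huv =>
    Prod.Lex.toLex_lt_toLex.2 (Or.inl huv)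
  refine (posetDim_le_of_fintype (fun s u v => key s u ≤ key s v)
    (fun s => ⟨isLinearOrder_of_injective _ (hkey s), ?_⟩) ?_).trans_eq (by simp [mul_comm])
  · intro u v huv
    rcases huv.eq_or_lt with rfl | huv
    · exact le_rfl
    have hw := weight_lt_of_lt (Subtype.coe_lt_coe.2 huv)
    obtain ⟨hu, hv⟩ : weight u.1 = j ∧ weight v.1 = j + 1 := by
      have := u.2; have := v.2; omega
    have hi := (h u.1 v.1 (fun h' => huv.ne (Subtype.ext h'))).1
      ((AdjacentLevels.adj_iff_of_lower hu hv).2 huv.le) s.1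
    have hval : val s u ≤ val s v := by
      simp only [val, hu, hv, if_true, if_neg (Nat.succ_ne_self j)]
      split_ifs <;> linarith
    rcases hval.lt_or_eq with hval | hval
    · exact (hlt s u v hval).le
    · exact (Prod.Lex.toLex_lt_toLex.2
        (Or.inr ⟨hval, Prod.Lex.toLex_lt_toLex.2 (Or.inl hw)⟩)).le
  · intro u v huv
    by_contra hle
    have hne : u.1 ≠ v.1 := fun h' => hle (Subtype.ext h').le
    by_cases hadj : (hypercube d).Adj u.1 v.1
    · rcases le_total (weight u.1) (weight v.1) with hw | hw
      · exact hle ((adj_iff hw).1 hadj).1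
      · obtain ⟨h1, h2⟩ := (adj_iff hw).1 hadj.symm
        obtain ⟨hu, hv⟩ : weight u.1 = j + 1 ∧ weight v.1 = j := by
          have := u.2; have := v.2; omega
        obtain ⟨i⟩ := ‹Nonempty ι›
        refine absurd (huv (i, true)) (not_le.2 ?_)
        have hi := ((h _ _ hne).1 hadj i).2
        have hval : val (i, true) v ≤ val (i, true) u := by
          simpa [val, hu, hv] using hi
        rcases hval.lt_or_eq with hval | hval
        · exact hlt _ _ _ hval
        · exact Prod.Lex.toLex_lt_toLex.2
            (Or.inr ⟨hval, Prod.Lex.toLex_lt_toLex.2 (Or.inl (by omega))⟩)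
    · -- disjoint intervals are ordered oppositely by the two extensions of their coordinate
      rw [h _ _ hne] at hadj
      push Not at hadj
      obtain ⟨i, hi⟩ := hadj
      have hu := hab u.1 i
      have hv := hab v.1 i
      have hsep : b v.1 i < a u.1 i ∨ b u.1 i < a v.1 i := by
        rcases lt_or_ge (b v.1 i) (a u.1 i) with h1 | h1
        · exact Or.inl h1
        · exact Or.inr (hi h1)
      rcases hsep with hs | hs
      · refine absurd (huv (i, true)) (not_le.2 (hlt _ _ _ ?_))
        simp only [val, if_true]
        split_ifs <;> linarith
      · refine absurd (huv (i, false)) (not_le.2 (hlt _ _ _ ?_))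
        simp only [val, Bool.false_eq_true, if_false]
        split_ifs <;> linarith

theorem weight_single {d : ℕ} (i : Fin d) : weight (Pi.single i 1 : Fin d → Fin 2) = 1 := by
  have : ones (Pi.single i 1 : Fin d → Fin 2) = {i} := by
    ext k; by_cases hk : k = i <;> simp [mem_ones, hk]
  rw [← card_ones, this, Finset.card_singleton]

theorem single_not_le_single {d : ℕ} {i k : Fin d} (h : i ≠ k) :
    ¬ (Pi.single i 1 : Fin d → Fin 2) ≤ Pi.single k 1 := by
  intro hle
  have := hle i
  simp [h] at this

theorem boxicity_hypercube_pos {d : ℕ} (hd : 2 ≤ d) : 0 < boxicity (hypercube d) := by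
  obtain ⟨a, b, -, h⟩ := exists_intervals_of_boxicity (hypercube d)
  by_contra h0
  let i : Fin d := ⟨0, by omega⟩
  let k : Fin d := ⟨1, by omega⟩
  have hik : i ≠ k := by simp [i, k]
  have hne : (Pi.single i 1 : Fin d → Fin 2) ≠ Pi.single k 1 := fun h' =>
    single_not_le_single hik h'.le
  have hadj := (h _ _ hne).2 fun s => absurd s.pos (by omega)
  have := ((adj_iff (by rw [weight_single, weight_single])).1 hadj).1
  exact single_not_le_single hik this

theorem maxAdjacentLevelsDim_le_two_mul_boxicity {d : ℕ} (hd : 2 ≤ d) :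
    maxAdjacentLevelsDim d ≤ 2 * boxicity (hypercube d) := by
  have hpos := boxicity_hypercube_pos hd
  have : Nonempty (Fin (boxicity (hypercube d))) := ⟨⟨0, hpos⟩⟩
  obtain ⟨a, b, hab, h⟩ := exists_intervals_of_boxicity (hypercube d)
  refine Finset.sup_le fun j _ => ?_
  simpa using posetDim_adjacentLevels_le a b hab h j

theorem two_le_maxAdjacentLevelsDim {d : ℕ} (hd : 2 ≤ d) : 2 ≤ maxAdjacentLevelsDim d := by
  refine le_trans ?_ (Finset.le_sup (f := fun j => posetDim (AdjacentLevels d j))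
    (Finset.mem_range.2 (show 0 < d by omega)))
  by_contra hlt
  obtain ⟨hpos, L, hL, hle⟩ := exists_realiser_posetDim (AdjacentLevels d 0)
  let i : Fin d := ⟨0, by omega⟩
  let k : Fin d := ⟨1, by omega⟩
  have hik : i ≠ k := by simp [i, k]
  let u : AdjacentLevels d 0 := ⟨Pi.single i 1, Or.inr (weight_single i)⟩
  let v : AdjacentLevels d 0 := ⟨Pi.single k 1, Or.inr (weight_single k)⟩
  -- a single linear extension would compare the incomparable singletons `u` and `v`
  have hsub : ∀ s, s = (⟨0, hpos⟩ : Fin (posetDim (AdjacentLevels d 0))) := fun s =>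
    Fin.ext (by have := s.2; simp only; omega)
  rcases (hL ⟨0, hpos⟩).1.total u v with h | h
  · exact single_not_le_single hik ((hle u v).2 fun s => hsub s ▸ h)
  · exact single_not_le_single hik.symm ((hle v u).2 fun s => hsub s ▸ h)

/-! ### Boxicity from realisers of adjacent levels -/

/-- A family, indexed by `ι`, of real-valued positions of the vertices of the cube that realises
the order between every two adjacent levels `j` and `j + 1`: smaller vertices have smaller or equal
positions, and every incomparable pair is reversed by some member of the family. There is one
position function for each `j`; its values off the levels `j` and `j + 1` are irrelevant, but stay
in `[0, 1]`. -/
structure IsLevelRealiser {d : ℕ} {ι : Type*} (pos : ℕ → ι → (Fin d → Fin 2) → ℝ) : Prop where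
  nonneg : ∀ j i v, 0 ≤ pos j i v
  le_one : ∀ j i v, pos j i v ≤ 1
  mono : ∀ j i u v, weight u = j → weight v = j + 1 → u ≤ v → pos j i u ≤ pos j i v
  reverses : ∀ j u v, weight u = j → weight v = j + 1 → ¬ u ≤ v → ∃ i, pos j i v < pos j i u

theorem boxicity_hypercube_le_of_isLevelRealiser {d : ℕ} {ι : Type*} [Fintype ι] [Nonempty ι]
    {pos : ℕ → ι → (Fin d → Fin 2) → ℝ} (hpos : IsLevelRealiser pos) :
    boxicity (hypercube d) ≤ 2 * Fintype.card ι + 2 := by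
  let e := Fintype.equivFin (Fin d → Fin 2)
  let N : ℝ := Fintype.card (Fin d → Fin 2)
  -- Intervals `(r, i)`: level `j ≡ r` mod 2 goes from `j - 1` into `[j, j + 1]`, and level `j + 1`
  -- goes from there to `j + 1`; the positions decide about the intersections within `[j, j + 1]`.
  let a : (Fin d → Fin 2) → (Fin 2 × ι) ⊕ Fin 2 → ℝ := fun v s => match s with
    | .inl (r, i) => if weight v % 2 = r then (weight v : ℝ) - 1
        else (weight v : ℝ) - 1 + (1 - pos (weight v - 1) i v) / 2
    | .inr r => if weight v % 2 = r then (e v : ℝ) else 0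
  let b : (Fin d → Fin 2) → (Fin 2 × ι) ⊕ Fin 2 → ℝ := fun v s => match s with
    | .inl (r, i) => if weight v % 2 = r then (weight v : ℝ) + (1 - pos (weight v) i v) / 2
        else (weight v : ℝ)
    | .inr r => if weight v % 2 = r then (e v : ℝ) else N
  have heN : ∀ v, (e v : ℝ) ≤ N := fun v => Nat.cast_le.2 (e v).2.le
  have hab : ∀ v s, a v s ≤ b v s := by
    rintro v (⟨r, i⟩ | r)
    · have h1 := hpos.nonneg (weight v) i v
      have h2 := hpos.le_one (weight v) i v
      have h3 := hpos.nonneg (weight v - 1) i v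
      have h4 := hpos.le_one (weight v - 1) i v
      simp only [a, b]
      split_ifs <;> linarith
    · have := heN v
      simp only [a, b]
      split_ifs <;> linarith [(Nat.cast_nonneg (e v) : (0 : ℝ) ≤ (e v : ℕ))]
  have hadj : ∀ u v, (hypercube d).Adj u v → weight u ≤ weight v →
      ∀ s, a u s ≤ b v s ∧ a v s ≤ b u s := by
    intro u v huv hw s
    obtain ⟨hle, hw'⟩ := (adj_iff hw).1 huv
    rcases s with ⟨r, i⟩ | r
    · have h1 := hpos.nonneg (weight u) i u
      have h2 := hpos.le_one (weight u) i u
      have h3 := hpos.nonneg (weight u - 1) i u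
      have h4 := hpos.le_one (weight u - 1) i u
      have h5 := hpos.nonneg (weight u + 1) i v
      have h6 := hpos.le_one (weight u + 1) i v
      have h7 := hpos.mono (weight u) i u v rfl hw' hle
      have h8 := hpos.le_one (weight u) i v
      simp only [a, b, hw', Nat.add_sub_cancel]
      push_cast
      have hr := r.2
      split_ifs <;> first | omega | constructor <;> linarith
    · have h1 := heN u
      have h2 := heN v
      have h3 : (0 : ℝ) ≤ (e u : ℕ) := Nat.cast_nonneg _
      have h4 : (0 : ℝ) ≤ (e v : ℕ) := Nat.cast_nonneg _
      simp only [a, b, hw']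
      split_ifs <;> first | omega | constructor <;> linarith
  have hnonadj : ∀ u v, u ≠ v → weight u ≤ weight v →
      (∀ s, a u s ≤ b v s ∧ a v s ≤ b u s) → (hypercube d).Adj u v := by
    intro u v huv hw hs
    rcases (by omega : weight v = weight u ∨ weight v = weight u + 1 ∨ weight u + 2 ≤ weight v)
      with h | h | h
    · exfalso
      have hsr := hs (.inr ⟨weight u % 2, Nat.mod_lt _ (by norm_num)⟩)
      simp only [a, b, h, if_true] at hsr
      have : (e u : ℕ) = e v := by exact_mod_cast le_antisymm hsr.1 hsr.2
      exact huv (e.injective (Fin.ext this))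
    · refine (adj_iff hw).2 ⟨?_, h⟩
      by_contra hle
      obtain ⟨i, hi⟩ := hpos.reverses (weight u) u v rfl h hle
      have hsr := (hs (.inl (⟨weight u % 2, Nat.mod_lt _ (by norm_num)⟩, i))).2
      simp only [a, b, h, if_true, if_neg (show ¬ (weight u + 1) % 2 = weight u % 2 by omega),
        Nat.add_sub_cancel] at hsr
      push_cast at hsr
      linarith
    · exfalso
      obtain ⟨i⟩ := ‹Nonempty ι›
      have hsr := (hs (.inl (⟨weight u % 2, Nat.mod_lt _ (by norm_num)⟩, i))).2
      simp only [a, b, if_true] at hsr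
      have h' : (weight u : ℝ) + 2 ≤ weight v := by exact_mod_cast h
      have h1 := hpos.nonneg (weight u) i u
      have h2 := hpos.le_one (weight v - 1) i v
      split_ifs at hsr <;> linarith
  refine (boxicity_le_of_intervals _ a b hab fun u v huv => ?_).trans_eq ?_
  · rcases le_total (weight u) (weight v) with hw | hw
    · exact ⟨fun h => hadj u v h hw, hnonadj u v huv hw⟩
    · exact ⟨fun h s => (hadj v u h.symm hw s).symm,
        fun h => (hnonadj v u huv.symm hw fun s => (h s).symm).symm⟩
  · simp

/-! ### Position functions from linear extensions and from keys -/

theorem card_filter_div_card_mem_Icc {α : Type*} [Fintype α] (p : α → Prop) [DecidablePred p] :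
    ((Finset.univ.filter p).card : ℝ) / Fintype.card α ∈ Set.Icc (0 : ℝ) 1 := by
  refine ⟨by positivity, div_le_one_of_le₀ ?_ (by positivity)⟩
  exact_mod_cast Finset.card_le_univ _

open Classical in
theorem exists_position_of_isLinearOrder {P : Type*} [Fintype P] (L : P → P → Prop)
    (hL : IsLinearOrder P L) :
    ∃ f : P → ℝ, (∀ x, f x ∈ Set.Icc (0 : ℝ) 1) ∧ ∀ x y, L x y ↔ f x ≤ f y := by
  have hmono : ∀ x y, L x y → Finset.univ.filter (L · x) ⊆ Finset.univ.filter (L · y) := by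
    intro x y hxy z hz
    simp only [Finset.mem_filter, Finset.mem_univ, true_and] at hz ⊢
    exact hL.trans _ _ _ hz hxy
  refine ⟨fun x => (Finset.univ.filter (L · x)).card / Fintype.card P,
    fun x => card_filter_div_card_mem_Icc _, fun x y => ?_⟩
  have : Nonempty P := ⟨x⟩
  rw [div_le_div_iff_of_pos_right (by exact_mod_cast Fintype.card_pos), Nat.cast_le]
  refine ⟨fun h => Finset.card_le_card (hmono x y h), fun h => ?_⟩
  by_contra hxy
  have hyx := (hL.total x y).resolve_left hxy
  have := Finset.eq_of_subset_of_card_le (hmono y x hyx) h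
  have hx : x ∈ Finset.univ.filter (L · y) := by rw [this]; simp [hL.refl x]
  simp only [Finset.mem_filter, Finset.mem_univ, true_and] at hx
  exact hxy hx

theorem exists_isLevelRealiser_of_posetDim {d k : ℕ}
    (h : ∀ j < d, posetDim (AdjacentLevels d j) ≤ k) :
    ∃ pos : ℕ → Fin k → (Fin d → Fin 2) → ℝ, IsLevelRealiser pos := by
  classical
  have key : ∀ j, ∃ p : Fin k → (Fin d → Fin 2) → ℝ,
      (∀ i v, p i v ∈ Set.Icc (0 : ℝ) 1) ∧ ∀ u v, weight u = j → weight v = j + 1 →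
        (u ≤ v → ∀ i, p i u ≤ p i v) ∧ (¬ u ≤ v → ∃ i, p i v < p i u) := by
    intro j
    rcases Nat.lt_or_ge j d with hj | hj
    · obtain ⟨hpos, L, hL, hle⟩ := exists_realiser_posetDim (AdjacentLevels d j)
      choose f hf hfL using fun i => exists_position_of_isLinearOrder (L i) (hL i).1
      -- the realiser is padded to size `k` by repeating its last member
      let c : Fin k → Fin (posetDim (AdjacentLevels d j)) := fun i =>
        ⟨min i (posetDim (AdjacentLevels d j) - 1), by omega⟩
      refine ⟨fun i v => if hv : weight v = j ∨ weight v = j + 1 then f (c i) ⟨v, hv⟩ else 0,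
        fun i v => ?_, fun u v hu hv => ?_⟩
      · dsimp only
        split_ifs
        · exact hf _ _
        · simp
      · rw [← Subtype.mk_le_mk (p := fun v => weight v = j ∨ weight v = j + 1)
          (hx := Or.inl hu) (hy := Or.inr hv), hle]
        simp only [hu, hv, true_or, or_true, dif_pos]
        refine ⟨fun hi i => (hfL _ _ _).1 (hi _), fun hi => ?_⟩
        push Not at hi
        obtain ⟨i, hi⟩ := hi
        refine ⟨⟨i, i.2.trans_le (h j hj)⟩, ?_⟩
        have hci : c ⟨i, i.2.trans_le (h j hj)⟩ = i := by
          apply Fin.ext; simp only [c]; have := i.2; omega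
        rw [hci]
        rw [hfL, not_le] at hi
        exact hi
    · refine ⟨fun _ _ => 0, by simp, fun u v _ hv => ?_⟩
      have := weight_le v
      omega
  choose p hp hp' using key
  exact ⟨p, fun j i v => (hp j i v).1, fun j i v => (hp j i v).2,
    fun j i u v hu hv h => (hp' j u v hu hv).1 h i, fun j u v hu hv => (hp' j u v hu hv).2⟩

/-- It suffices to order each level: a vertex `v` of level `j + 1` is placed right behind the last
of its lower neighbours, so it comes before every `u` of level `j` that lies behind all of these. -/
theorem exists_isLevelRealiser_of_keys {d : ℕ} {ι K : Type*} [LinearOrder K]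
    (κ : ι → (Fin d → Fin 2) → K)
    (h : ∀ u v, weight v = weight u + 1 → ¬ u ≤ v →
      ∃ i, ∀ w ≤ v, weight w = weight u → κ i w < κ i u) :
    ∃ pos : ℕ → ι → (Fin d → Fin 2) → ℝ, IsLevelRealiser pos := by
  classical
  let S : ℕ → ι → (Fin d → Fin 2) → Finset (Fin d → Fin 2) := fun j i v =>
    Finset.univ.filter fun t => ∃ w ≤ v, weight w = j ∧ κ i t ≤ κ i w
  refine ⟨fun j i v => (S j i v).card / Fintype.card (Fin d → Fin 2),
    fun j i v => (card_filter_div_card_mem_Icc _).1, fun j i v => (card_filter_div_card_mem_Icc _).2,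
    fun j i u v _ _ huv => ?_, fun j u v hu hv huv => ?_⟩
  · refine div_le_div_of_nonneg_right (Nat.cast_le.2 (Finset.card_le_card ?_)) (by positivity)
    intro t ht
    simp only [S, Finset.mem_filter, Finset.mem_univ, true_and] at ht ⊢
    obtain ⟨w, hw, h⟩ := ht
    exact ⟨w, hw.trans huv, h⟩
  · subst hu
    obtain ⟨i, hi⟩ := h u v hv huv
    refine ⟨i, div_lt_div_of_pos_right (Nat.cast_lt.2 (Finset.card_lt_card ?_))
      (by exact_mod_cast Fintype.card_pos)⟩
    refine (Finset.ssubset_iff_of_subset ?_).2 ⟨u, ?_, ?_⟩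
    · intro t ht
      simp only [S, Finset.mem_filter, Finset.mem_univ, true_and] at ht ⊢
      obtain ⟨w, hw, hw', h⟩ := ht
      exact ⟨u, le_rfl, rfl, h.trans (hi w hw hw').le⟩
    · simp only [S, Finset.mem_filter, Finset.mem_univ, true_and]
      exact ⟨u, le_rfl, rfl, le_rfl⟩
    · simp only [S, Finset.mem_filter, Finset.mem_univ, true_and]
      rintro ⟨w, hw, hw', h⟩
      exact absurd h (not_le.2 (hi w hw hw'))

/-! ### Ordering a level along ordered partitions -/

/-- The sort key of a set `A` with respect to the ordered partition of the ground set into the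
fibres of `c`: it lists, for each part in turn, the number of elements of `A` in this part, and then
an injective code of their set. Keys are compared lexicographically. The sign `s` selects one of two
opposite ways to break a tie in cardinality. -/
noncomputable def partKey {d : ℕ} {M : Type*} [LinearOrder M] (c : Fin d → M) (s : Bool)
    (A : Finset (Fin d)) : Lex (M → ℕ ×ₗ ℤ) :=
  toLex fun m => toLex ((A.filter fun x => c x = m).card,
    (if s then 1 else -1) *
      ((Fintype.equivFin (Finset (Fin d)) (A.filter fun x => c x = m) : ℕ) : ℤ))

/-- If `m` is the first part in which `A` and `B` differ, and `A` has there at least as many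
elements as `B`, then `A` comes after all sets that arise from `B` by deleting an element. -/
theorem exists_partKey_lt {d : ℕ} {M : Type*} [LinearOrder M] (c : Fin d → M)
    {A B : Finset (Fin d)} {m : M}
    (hlt : ∀ m' < m, A.filter (fun x => c x = m') = B.filter (fun x => c x = m'))
    (hne : A.filter (fun x => c x = m) ≠ B.filter (fun x => c x = m))
    (hcard : (B.filter fun x => c x = m).card ≤ (A.filter fun x => c x = m).card) :
    ∃ s, ∀ b ∈ B, partKey c s (B.erase b) < partKey c s A := by
  let code : Finset (Fin d) → ℤ := fun T => ((Fintype.equivFin (Finset (Fin d)) T : ℕ) : ℤ)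
  have hcode : Function.Injective code := fun T T' h =>
    (Fintype.equivFin _).injective (Fin.ext (Int.ofNat_injective h))
  obtain ⟨s, hs⟩ : ∃ s : Bool, (if s then 1 else -1) * code (B.filter fun x => c x = m) <
      (if s then 1 else -1) * code (A.filter fun x => c x = m) := by
    rcases lt_or_gt_of_ne (hcode.ne hne) with h | h
    · exact ⟨false, by simpa using h⟩
    · exact ⟨true, by simpa using h⟩
  refine ⟨s, fun b hb => ?_⟩
  have herase : ∀ m', c b ≠ m' →
      (B.erase b).filter (fun x => c x = m') = B.filter (fun x => c x = m') := by
    intro m' hm'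
    rw [Finset.filter_erase, Finset.erase_eq_of_notMem]
    simp [hm']
  have hcb : ((B.erase b).filter fun x => c x = c b).card < (B.filter fun x => c x = c b).card := by
    rw [Finset.filter_erase]
    exact Finset.card_erase_lt_of_mem (by simp [hb])
  rcases lt_trichotomy (c b) m with h | h | h
  · refine ⟨c b, fun m' hm' => ?_, Prod.Lex.toLex_lt_toLex.2 (Or.inl ?_)⟩
    · simp only [partKey, Pi.toLex_apply]
      rw [herase m' hm'.ne', hlt m' (hm'.trans h)]
    · exact hcb.trans_eq (congrArg Finset.card (hlt _ h).symm)
  · refine ⟨m, fun m' hm' => ?_, Prod.Lex.toLex_lt_toLex.2 (Or.inl ?_)⟩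
    · simp only [partKey, Pi.toLex_apply]
      rw [herase m' (h ▸ hm'.ne'), hlt m' hm']
    · subst h
      exact hcb.trans_le hcard
  · refine ⟨m, fun m' hm' => ?_, Prod.Lex.toLex_lt_toLex.2 ?_⟩
    · simp only [partKey, Pi.toLex_apply]
      rw [herase m' (hm'.trans h).ne', hlt m' hm']
    · simp only [herase m h.ne']
      exact hcard.lt_or_eq.imp_right fun h' => ⟨h', hs⟩

/-- For each `i`, the ordered partition of the ground set into the fibres of `c i` orders every
level of the cube, in two ways that differ in the breaking of ties. -/
theorem exists_isLevelRealiser_of_parts {d : ℕ} {ι M : Type*} [LinearOrder M] [WellFoundedLT M]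
    (c : ι → Fin d → M)
    (h : ∀ A B : Finset (Fin d), B.card = A.card + 1 → ¬ A ⊆ B → ∃ i m,
      (∀ m' < m, A.filter (fun x => c i x = m') = B.filter (fun x => c i x = m')) ∧
      A.filter (fun x => c i x = m) ≠ B.filter (fun x => c i x = m) ∧
      (B.filter fun x => c i x = m).card ≤ (A.filter fun x => c i x = m).card) :
    ∃ pos : ℕ → ι × Bool → (Fin d → Fin 2) → ℝ, IsLevelRealiser pos := by
  refine exists_isLevelRealiser_of_keys (fun i v => partKey (c i.1) i.2 (ones v))
    fun u v hw huv => ?_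
  obtain ⟨r, m, h1, h2, h3⟩ := h (ones u) (ones v) hw (by rwa [ones_subset])
  obtain ⟨s, hs⟩ := exists_partKey_lt _ h1 h2 h3
  refine ⟨(r, s), fun w hwv hwu => ?_⟩
  -- `w` arises from `v` by deleting one element
  have hsub := ones_subset.2 hwv
  obtain ⟨b, hb⟩ := Finset.card_eq_one.1 (show (ones v \ ones w).card = 1 by
    rw [Finset.card_sdiff_of_subset hsub, card_ones, card_ones]; omega)
  have hbv : b ∈ ones v := (Finset.mem_sdiff.1 (hb ▸ Finset.mem_singleton_self b)).1
  have : ones w = (ones v).erase b := by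
    rw [← Finset.sdiff_singleton_eq_erase, ← hb, Finset.sdiff_sdiff_eq_self hsub]
  rw [this]
  exact hs b hbv

/-- The label of the part that contains the word `w` in the ordered partition for the letter `r`.
Two words have the same label if and only if they agree up to and including their letter `r`, and
labels are compared lexicographically with `r` before all other letters: every position from the
letter `r` on is overwritten by `0`, and any other letter `l` is written as `l + 1`. -/
def cutWord {q : ℕ} (r : Fin q) (w : Equiv.Perm (Fin q)) : Lex (Fin q → Fin (q + 1)) :=
  toLex fun p => if ∃ p' ≤ p, w p' = r then 0 else (w p).succ

/-- For suitable `r`, the first part `m` in which `A` and `B` differ contains at least as many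
elements of `A` as of `B`. -/
theorem exists_cutWord {d q : ℕ} (φ : Fin d → Equiv.Perm (Fin q)) (hφ : Function.Injective φ)
    {A B : Finset (Fin d)} (hcard : B.card = A.card + 1) (hAB : ¬ A ⊆ B) :
    ∃ (r : Fin q) (m : Lex (Fin q → Fin (q + 1))),
      (∀ m' < m, A.filter (fun x => cutWord r (φ x) = m') = B.filter (fun x => cutWord r (φ x) = m'))
      ∧ A.filter (fun x => cutWord r (φ x) = m) ≠ B.filter (fun x => cutWord r (φ x) = m) ∧
      (B.filter fun x => cutWord r (φ x) = m).card ≤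
        (A.filter fun x => cutWord r (φ x) = m).card := by
  have hcard' : (B \ A).card = (A \ B).card + 1 := by
    have h1 := Finset.card_sdiff_add_card_inter A B
    have h2 := Finset.card_sdiff_add_card_inter B A
    rw [Finset.inter_comm] at h2
    omega
  set D := symmDiff A B with hD
  have hmemD : ∀ x, x ∈ D ↔ x ∈ A ∧ x ∉ B ∨ x ∈ B ∧ x ∉ A := fun x => by
    rw [hD, Finset.mem_symmDiff]
  -- the first position at which the words of the elements of `D` are not all the same
  obtain ⟨p, ⟨y, hy, z, hz, hyz⟩, hmin⟩ :
      ∃ p ∈ {p | ∃ y ∈ D, ∃ z ∈ D, φ y p ≠ φ z p}, ∀ p' ∈ {p | ∃ y ∈ D, ∃ z ∈ D, φ y p ≠ φ z p},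
        ¬ p' < p := by
    refine WellFounded.has_min wellFounded_lt _ ?_
    obtain ⟨y, hyA, hyB⟩ := Finset.not_subset.1 hAB
    obtain ⟨z, hz⟩ := Finset.card_pos.1 (show 0 < (B \ A).card by omega)
    rw [Finset.mem_sdiff] at hz
    have hne : φ y ≠ φ z := fun h => hyB (hφ h ▸ hz.1)
    obtain ⟨p, hp⟩ := not_forall.1 fun h => hne (Equiv.ext h)
    exact ⟨p, y, (hmemD y).2 (Or.inl ⟨hyA, hyB⟩), z, (hmemD z).2 (Or.inr hz), hp⟩
  have hpre : ∀ x ∈ D, ∀ x' ∈ D, ∀ p' < p, φ x p' = φ x' p' := by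
    intro x hx x' hx' p' hp'
    by_contra hne
    exact hmin p' ⟨x, hx, x', hx', hne⟩ hp'
  -- at least two letters occur at `p`, and the excess of `B` over `A` is only `1`
  obtain ⟨r, ⟨x₀, hx₀, hr⟩, hle⟩ : ∃ r, (∃ x ∈ D, φ x p = r) ∧
      ((B \ A).filter fun x => φ x p = r).card ≤ ((A \ B).filter fun x => φ x p = r).card := by
    by_contra hcon
    push Not at hcon
    set R := D.image fun x => φ x p
    have hA : (A \ B).card = ∑ r ∈ R, ((A \ B).filter fun x => φ x p = r).card :=
      Finset.card_eq_sum_card_fiberwise fun x hx =>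
        Finset.mem_image_of_mem _ ((hmemD x).2 (Or.inl (Finset.mem_sdiff.1 hx)))
    have hB : (B \ A).card = ∑ r ∈ R, ((B \ A).filter fun x => φ x p = r).card :=
      Finset.card_eq_sum_card_fiberwise fun x hx =>
        Finset.mem_image_of_mem _ ((hmemD x).2 (Or.inr (Finset.mem_sdiff.1 hx)))
    have hR : 1 < R.card := Finset.one_lt_card.2
      ⟨_, Finset.mem_image_of_mem _ hy, _, Finset.mem_image_of_mem _ hz, hyz⟩
    have hsum : ∑ r ∈ R, (((A \ B).filter fun x => φ x p = r).card + 1) ≤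
        ∑ r ∈ R, ((B \ A).filter fun x => φ x p = r).card := by
      refine Finset.sum_le_sum fun r hr => ?_
      obtain ⟨x, hx, hxr⟩ := Finset.mem_image.1 hr
      exact hcon r ⟨x, hx, hxr⟩
    rw [Finset.sum_add_distrib, ← hA, ← hB] at hsum
    simp only [Finset.sum_const, smul_eq_mul, mul_one] at hsum
    omega
  have hno : ∀ x ∈ D, ∀ p' < p, φ x p' ≠ r := by
    intro x hx p' hp' h
    rw [hpre x hx x₀ hx₀ p' hp', ← hr] at h
    exact hp'.ne ((φ x₀).injective h)
  have heq : ∀ x ∈ D, φ x p = r → cutWord r (φ x) = cutWord r (φ x₀) := by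
    intro x hx hxr
    refine congrArg toLex (funext fun p'' => ?_)
    rcases lt_or_ge p'' p with h | h
    · rw [if_neg, if_neg, hpre x hx x₀ hx₀ p'' h]
      · rintro ⟨p', hp', h'⟩
        exact hno x₀ hx₀ p' (hp'.trans_lt h) h'
      · rintro ⟨p', hp', h'⟩
        exact hno x hx p' (hp'.trans_lt h) h'
    · rw [if_pos ⟨p, h, hxr⟩, if_pos ⟨p, h, hr⟩]
  have hlt : ∀ x ∈ D, φ x p ≠ r → cutWord r (φ x₀) < cutWord r (φ x) := by
    intro x hx hxr
    refine ⟨p, fun p'' h => ?_, ?_⟩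
    · simp only [cutWord, Pi.toLex_apply]
      rw [if_neg, if_neg, hpre x hx x₀ hx₀ p'' h]
      · rintro ⟨p', hp', h'⟩
        exact hno x hx p' (hp'.trans_lt h) h'
      · rintro ⟨p', hp', h'⟩
        exact hno x₀ hx₀ p' (hp'.trans_lt h) h'
    · simp only [cutWord, Pi.toLex_apply]
      rw [if_pos ⟨p, le_rfl, hr⟩, if_neg]
      · exact Fin.succ_pos _
      · rintro ⟨p', hp', h'⟩
        rcases hp'.lt_or_eq with hp' | rfl
        · exact hno x hx p' hp' h'
        · exact hxr h'
  have hiff : ∀ x ∈ D, cutWord r (φ x) = cutWord r (φ x₀) ↔ φ x p = r := fun x hx =>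
    ⟨fun h => by_contra fun hxr => (hlt x hx hxr).ne' h, heq x hx⟩
  refine ⟨r, cutWord r (φ x₀), fun m' hm' => ?_, fun h => ?_, ?_⟩
  · have hnot : ∀ x, cutWord r (φ x) = m' → x ∉ D := by
      intro x hx hxD
      by_cases hxr : φ x p = r
      · exact hm'.ne (hx ▸ heq x hxD hxr)
      · exact lt_asymm hm' (hx ▸ hlt x hxD hxr)
    ext x
    have h1 := hnot x
    rw [hmemD] at h1
    simp only [Finset.mem_filter]
    tauto
  · have h' := Finset.ext_iff.1 h x₀
    simp only [Finset.mem_filter, and_true] at h'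
    have := (hmemD x₀).1 hx₀
    tauto
  · have hsd : ∀ S T : Finset (Fin d), S \ T ⊆ D →
        S.filter (fun x => cutWord r (φ x) = cutWord r (φ x₀)) \
          T.filter (fun x => cutWord r (φ x) = cutWord r (φ x₀)) =
        (S \ T).filter fun x => φ x p = r := by
      intro S T hST
      ext x
      have h1 := hiff x
      have h2 := @hST x
      simp only [Finset.mem_sdiff, Finset.mem_filter] at h2 ⊢
      tauto
    have h1 := Finset.card_sdiff_add_card_inter
      (A.filter fun x => cutWord r (φ x) = cutWord r (φ x₀))
      (B.filter fun x => cutWord r (φ x) = cutWord r (φ x₀))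
    have h2 := Finset.card_sdiff_add_card_inter
      (B.filter fun x => cutWord r (φ x) = cutWord r (φ x₀))
      (A.filter fun x => cutWord r (φ x) = cutWord r (φ x₀))
    rw [hsd A B fun x hx => (hmemD x).2 (Or.inl (Finset.mem_sdiff.1 hx))] at h1
    rw [hsd B A fun x hx => (hmemD x).2 (Or.inr (Finset.mem_sdiff.1 hx)), Finset.inter_comm] at h2
    omega

theorem exists_isLevelRealiser_of_le_factorial {d q : ℕ} (h : d ≤ q.factorial) :
    ∃ pos : ℕ → Fin q × Bool → (Fin d → Fin 2) → ℝ, IsLevelRealiser pos := by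
  obtain ⟨φ⟩ : Nonempty (Fin d ↪ Equiv.Perm (Fin q)) :=
    Function.Embedding.nonempty_of_card_le (by simpa [Fintype.card_perm] using h)
  refine exists_isLevelRealiser_of_parts (fun r x => cutWord r (φ x)) fun A B hcard hAB => ?_
  -- the two statements differ in their order and decidability instances only
  convert exists_cutWord φ φ.injective hcard hAB
  rfl

/-! ### The bounds on the boxicity of the cube -/

theorem boxicity_hypercube_one : boxicity (hypercube 1) = 0 := by
  refine Nat.le_zero.1 ((boxicity_le_of_intervals (ι := Fin 0) _ (fun _ _ => 0) (fun _ _ => 0)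
    (fun _ _ => le_rfl) fun u v huv => ⟨fun _ i => i.elim0, fun _ => ?_⟩).trans_eq (by simp))
  refine ⟨0, ?_, fun j hj => absurd (Subsingleton.elim j 0) hj⟩
  simp only [SimpleGraph.top_adj]
  intro h
  exact huv (funext fun i => by rwa [Subsingleton.elim i 0])

theorem theorem2p4 (d : ℕ) (hd : 1 ≤ d) :
    (2 ≤ d → (1 / 2 : ℝ) * (maxAdjacentLevelsDim d : ℝ) ≤ (boxicity (hypercube d) : ℝ)) ∧
    boxicity (hypercube d) ≤ 3 * maxAdjacentLevelsDim d ∧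
    (3 ≤ d → (boxicity (hypercube d) : ℝ) ≤
      12 * Real.logb 2 (d : ℝ) / Real.logb 2 (Real.logb 2 (d : ℝ))) := by
  refine ⟨fun h2 => ?_, ?_, fun h3 => ?_⟩
  · have : (maxAdjacentLevelsDim d : ℝ) ≤ 2 * boxicity (hypercube d) := by
      exact_mod_cast maxAdjacentLevelsDim_le_two_mul_boxicity h2
    linarith
  · rcases hd.eq_or_lt with rfl | h2
    · simp [boxicity_hypercube_one]
    have hb := two_le_maxAdjacentLevelsDim h2
    have : Nonempty (Fin (maxAdjacentLevelsDim d)) := ⟨⟨0, by omega⟩⟩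
    obtain ⟨pos, hpos⟩ := exists_isLevelRealiser_of_posetDim (k := maxAdjacentLevelsDim d)
      fun j hj => Finset.le_sup (f := fun j => posetDim (AdjacentLevels d j))
        (Finset.mem_range.2 hj)
    have := boxicity_hypercube_le_of_isLevelRealiser hpos
    rw [Fintype.card_fin] at this
    omega
  · obtain ⟨q, hq, hdq, hle⟩ := exists_le_factorial h3
    have : Nonempty (Fin q) := ⟨⟨0, hq⟩⟩
    obtain ⟨pos, hpos⟩ := exists_isLevelRealiser_of_le_factorial hdq
    have hbox := boxicity_hypercube_le_of_isLevelRealiser hpos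
    rw [Fintype.card_prod, Fintype.card_fin, Fintype.card_bool] at hbox
    have : (boxicity (hypercube d) : ℝ) ≤ 4 * q + 2 := by
      exact_mod_cast hbox.trans_eq (by ring)
    exact this.trans hle
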